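/- Let $d\ge 1$, let $\mathcal H$ be a $d$-dimensional complex Hilbert space, let $\omega=e^{2\pi i/d}$, and let $(\varphi_h)_{h\in\mathbb Z_d}$ and $(\psi_k)_{k\in\mathbb Z_d}$ be orthonormal bases of $\mathcal H$ with $\psi_k=\frac1{\sqrt d}\sum_{h\in\mathbb Z_d}\omega^{hk}\varphi_h$ for all $k$. Let $q_\varphi,q_\psi>0$ with $q_\varphi+q_\psi=1$. Let $X=X_\varphi\cup X_\psi$ be the disjoint union of the label sets $X_\varphi=\{h\varphi: h\in\mathbb Z_d\}$ and $X_\psi=\{k\psi:k\in\mathbb Z_d\}$, let $\mathscr P=(X_\varphi,X_\psi)$, and let $\mathcal E$ be the state ensemble on $X$ given by $$\mathcal E(h\varphi)=\frac{q_\varphi}{d}|\varphi_h\rangle\langle\varphi_h|,\qquad \mathcal E(k\psi)=\frac{q_\psi}{d}|\psi_k\rangle\langle\psi_k| .$$ A measurement with outcomes in a finite set $Y$ is a map $\mathsf M$ from $Y$ to the positive operators on $\mathcal H$ with $\sum_y \mathsf M(y)=\mathbb 1$. For a measurement $\mathsf M$ on $Y$ and functions $f_\varphi:Y\to X_\varphi$,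 $f_\psi:Y\to X_\psi$, the guessing probability with post-measurement information is $$P^{\rm post}_{\rm guess}(\mathcal E;\mathscr P;\mathsf M,f)=\sum_{\ell\in\{\varphi,\psi\}}\ \sum_{x\in X_\ell}\operatorname{tr}\Big[\mathcal E(x)\sum_{y:\,f_\ell(y)=x}\mathsf M(y)\Big],$$ and $P^{\rm post}_{\rm guess}(\mathcal E;\mathscr P)$ is its maximum over all finite $Y$, all $\mathsf M$ and all $f_\varphi,f_\psi$. For a measurement $\mathsf C$ on $X_\varphi\times X_\psi$, let $P^{\rm post}_{\rm guess}(\mathcal E;\mathscr P;\mathsf C)$ be the guessing probability obtained with the two coordinate projections as $f_\varphi,f_\psi$. Then the maximum exists and $$P^{\rm post}_{\rm guess}(\mathcal E;\mathscr P)=\frac12\left[1+\sqrt{(q_\varphi-q_\psi)^2+\frac4d\,q_\varphi q_\psi}\right].$$ Moreover, the system $$\alpha>0,\quad\beta>0,\quad \alpha^2+\beta^2+\frac{2}{\sqrt d}\alpha\beta=1,\quad \frac\alpha\beta=\frac{\sqrt d}{2q_\psi}\left[q_\varphi-q_\psi+\sqrt{(q_\varphi-q_\psi)^2+\frac4d\,q_\varphi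 q_\psi}\right]$$ has exactly one real solution $(\alpha,\beta)$, and with this solution $$\mathsf C_0(h\varphi,k\psi)=\frac1d\,|\alpha\varphi_h+\beta\omega^{-hk}\psi_k\rangle\langle\alpha\varphi_h+\beta\omega^{-hk}\psi_k|=\frac1d\,W(h,k)\,|\alpha\varphi_0+\beta\psi_0\rangle\langle\alpha\varphi_0+\beta\psi_0|\,W(h,k)^*,$$ where $W(r,s)=\sum_{z\in\mathbb Z_d}\omega^{sz}|\varphi_{r+z}\rangle\langle\varphi_z|$, is a measurement on $X_\varphi\times X_\psi$ that maximizes $P^{\rm post}_{\rm guess}(\mathcal E;\mathscr P;\mathsf C)$ over all measurements $\mathsf C$ on $X_\varphi\times X_\psi$ and attains $P^{\rm post}_{\rm guess}(\mathcal E;\mathscr P)$. The measurement $\mathsf C_0$ is the unique measurement on $X_\varphi\times X_\psi$ maximizing $P^{\rm post}_{\rm guess}(\mathcal E;\mathscr P;\mathsf C)$ if and only if $d$ is odd. -/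

import Mathlib

open scoped BigOperators

namespace PostInfo

noncomputable section

/-- Linear operators on `H`. -/
abbrev Op (H : Type*) [NormedAddCommGroup H] [InnerProductSpace ℂ H] : Type _ := H →ₗ[ℂ] H

/-- The operator `|u⟩⟨v|`, that is, `w ↦ ⟨v, w⟩ u`. -/
def ketbra {H : Type*} [NormedAddCommGroup H] [InnerProductSpace ℂ H] (u v : H) : Op H :=
  (InnerProductSpace.rankOne ℂ u v : H →L[ℂ] H)

theorem ketbra_apply {H : Type*} [NormedAddCommGroup H] [InnerProductSpace ℂ H] (u v w : H) :
    ketbra u v w = (inner ℂ v w : ℂ) • u := rfl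

theorem ketbra_isPositive {H : Type*} [NormedAddCommGroup H] [InnerProductSpace ℂ H] (u : H) :
    (ketbra u u).IsPositive :=
  (InnerProductSpace.isPositive_rankOne_self (𝕜 := ℂ) u).toLinearMap

theorem ketbra_trace {H : Type*} [NormedAddCommGroup H] [InnerProductSpace ℂ H]
    [FiniteDimensional ℂ H] (u : H) (hu : ‖u‖ = 1) :
    LinearMap.trace ℂ H (ketbra u u) = 1 := by
  have h := InnerProductSpace.trace_rankOne (𝕜 := ℂ) u u
  rw [inner_self_eq_norm_sq_to_K, hu] at h
  simpa [ketbra] using h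

/-- A measurement (POVM) on `H` with outcomes in the finite set `Y`. -/
@[ext]
structure Measurement (H : Type*) [NormedAddCommGroup H] [InnerProductSpace ℂ H]
    (Y : Type*) [Fintype Y] where
  /-- The operator attached to each outcome. -/
  effect : Y → Op H
  pos : ∀ y, (effect y).IsPositive
  sum_eq_one : ∑ y, effect y = 1

/-- A state ensemble: states `ϱ_x` (positive operators of trace one) labelled by the finite set `X`,
together with prior probabilities `p(x)`. -/
structure StateEnsemble (H : Type*) [NormedAddCommGroup H] [InnerProductSpace ℂ H]
    (X : Type*) [Fintype X] where
  /-- The states. -/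
  state : X → Op H
  state_pos : ∀ x, (state x).IsPositive
  state_trace : ∀ x, LinearMap.trace ℂ H (state x) = 1
  /-- The prior probabilities. -/
  prob : X → ℝ
  prob_nonneg : ∀ x, 0 ≤ prob x
  prob_sum : ∑ x, prob x = 1

/-- A partition of the label set `X` into nonempty disjoint subsets `X_ℓ`, `ℓ ∈ I`. -/
structure LabelPartition (X I : Type*) where
  /-- The subset `X_ℓ`. -/
  part : I → Finset X
  nonempty : ∀ ℓ, (part ℓ).Nonempty
  disjoint : ∀ ℓ ℓ', ℓ ≠ ℓ' → Disjoint (part ℓ) (part ℓ')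
  cover : ∀ x, ∃ ℓ, x ∈ part ℓ

/-- The subset `X_ℓ`, as a type. -/
abbrev LabelPartition.Part {X I : Type*} (P : LabelPartition X I) (ℓ : I) : Type _ :=
  {x : X // x ∈ P.part ℓ}

section general

variable {H : Type*} [NormedAddCommGroup H] [InnerProductSpace ℂ H]

/-- The relabelled measurement `(f_* M)(x) = ∑_{y ∈ f⁻¹(x)} M(y)`. -/
def Measurement.pushforward {Y Z : Type*} [Fintype Y] [Fintype Z] [DecidableEq Z]
    (M : Measurement H Y) (f : Y → Z) : Measurement H Z where
  effect z := ∑ y with f y = z, M.effect y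
  pos z := by
    have key : ∀ s : Finset Y, (∑ y ∈ s, M.effect y).IsPositive := by
      intro s
      classical
      induction s using Finset.induction_on with
      | empty => simp
      | insert a s ha ih =>
        rw [Finset.sum_insert ha]
        exact (M.pos a).add ih
    exact key _
  sum_eq_one := by
    rw [← M.sum_eq_one]
    exact Finset.sum_fiberwise Finset.univ f M.effect

/-- The ensemble as a map into operators, `ℰ(x) = p(x) ϱ_x`. -/
def StateEnsemble.op {X : Type*} [Fintype X] (E : StateEnsemble H X) (x : X) : Op H :=
  (E.prob x : ℂ) • E.state x

/-- The guessing probability `∑_x tr[ℰ(x) M(x)]` of a measurement `M` for the ensemble given by the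
operators `ℰ(x)`. The traces are real, because all operators involved are positive. -/
def guessProb {X : Type*} [Fintype X] (E : X → Op H) (M : Measurement H X) : ℝ :=
  ∑ x, (LinearMap.trace ℂ H (E x * M.effect x)).re

variable {X I : Type*} [Fintype X] [DecidableEq X] [Fintype I] [DecidableEq I]

/-- The probability `q(ℓ) = ∑_{x ∈ X_ℓ} p(x)` that a label occurs in `X_ℓ`. -/
def StateEnsemble.partProb (E : StateEnsemble H X) (P : LabelPartition X I) (ℓ : I) : ℝ :=
  ∑ x ∈ P.part ℓ, E.prob x

/-- The subensemble `ℰ_ℓ(x) = ℰ(x) / q(ℓ)`, `x ∈ X_ℓ` (meaningful when `q(ℓ) ≠ 0`). -/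
def StateEnsemble.sub (E : StateEnsemble H X) (P : LabelPartition X I) (ℓ : I)
    (x : P.Part ℓ) : Op H :=
  ((E.partProb P ℓ)⁻¹ : ℂ) • E.op x

/-- The guessing probability with post-measurement information: Bob performs the measurement `M`,
and when he is told `ℓ` he guesses `f ℓ y`, where `y` is the outcome he obtained. -/
def postGuess (E : StateEnsemble H X) (P : LabelPartition X I) {Y : Type*} [Fintype Y]
    (M : Measurement H Y) (f : ∀ ℓ, Y → P.Part ℓ) : ℝ :=
  ∑ ℓ, E.partProb P ℓ * guessProb (E.sub P ℓ) (M.pushforward (f ℓ))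

/-- All guessing probabilities with post-measurement information that Bob can achieve, over all
finite outcome sets, all measurements and all relabelling functions. The optimal guessing
probability with post-measurement information is the greatest element of this set. -/
def postGuessValues (E : StateEnsemble H X) (P : LabelPartition X I) : Set ℝ :=
  {p | ∃ (Y : Type) (_ : Fintype Y) (M : Measurement H Y) (f : ∀ ℓ, Y → P.Part ℓ),
    p = postGuess E P M f}

/-- The guessing probability with post-measurement information for a measurement whose outcome set
is the Cartesian product of the `X_ℓ`, the relabelling functions being the projections. -/
def postGuessProd (E : StateEnsemble H X) (P : LabelPartition X I)
    (C : Measurement H (∀ ℓ, P.Part ℓ)) : ℝ :=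
  postGuess E P C (fun ℓ x => x ℓ)

end general

section mub

variable {d : ℕ} [NeZero d] {H : Type*} [NormedAddCommGroup H] [InnerProductSpace ℂ H]

/-- `ω^z` for `z ∈ ℤ_d`, where `ω = exp(2πi/d)`. -/
def omegaPow (z : ZMod d) : ℂ := ZMod.stdAddChar z

theorem omegaPow_natCast (n : ℕ) :
    omegaPow (n : ZMod d) = Complex.exp (2 * Real.pi * Complex.I / d) ^ n := by
  have h := ZMod.stdAddChar_coe (N := d) (n : ℤ)
  rw [← Complex.exp_nat_mul]
  simp only [Int.cast_natCast] at h
  rw [omegaPow, h]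
  congr 1
  ring

/-- `ψ` is the Fourier conjugate of `φ`: `ψ_k = d^{-1/2} ∑_h ω^{hk} φ_h`. -/
def IsFourierConjugate (φ ψ : OrthonormalBasis (ZMod d) ℂ H) : Prop :=
  ∀ k, ψ k = ((1 / Real.sqrt d : ℝ) : ℂ) • ∑ h, omegaPow (h * k) • φ h

/-- The generalized Pauli operators `W(r,s) = ∑_z ω^{sz} |φ_{r+z}⟩⟨φ_z|`. -/
def weyl (φ : OrthonormalBasis (ZMod d) ℂ H) (r s : ZMod d) : Op H :=
  ∑ z, omegaPow (s * z) • ketbra (φ (r + z)) (φ z)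

/-- The label set `X = X_φ ∪ X_ψ` of the two bases: `(0, h)` is the label of `φ_h`, and `(1, h)` is
the label of `ψ_h`. -/
abbrev MubLabel (d : ℕ) : Type := Fin 2 × ZMod d

/-- The partition of the label set into `X_φ` (index `0`) and `X_ψ` (index `1`). -/
def mubPartition (d : ℕ) [NeZero d] : LabelPartition (MubLabel d) (Fin 2) where
  part ℓ := Finset.univ.filter fun x => x.1 = ℓ
  nonempty ℓ := ⟨(ℓ, 0), by simp⟩
  disjoint ℓ ℓ' h := by
    rw [Finset.disjoint_left]
    intro x hx hx'
    simp only [Finset.mem_filter, Finset.mem_univ, true_and] at hx hx'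
    exact h (hx.symm.trans hx')
  cover x := ⟨x.1, by simp⟩

/-- The label `hℓ`, as an element of `X_ℓ`. -/
def mubLabel (ℓ : Fin 2) (h : ZMod d) : (mubPartition d).Part ℓ :=
  ⟨(ℓ, h), by simp [mubPartition]⟩

/-- The element `(hφ, kψ)` of the Cartesian product `X_φ × X_ψ`. -/
def mubPair (h k : ZMod d) : ∀ ℓ, (mubPartition d).Part ℓ :=
  fun ℓ => mubLabel ℓ (![h, k] ℓ)

/-- The ensemble `ℰ(hφ) = (q_φ/d) |φ_h⟩⟨φ_h|`, `ℰ(kψ) = (q_ψ/d) |ψ_k⟩⟨ψ_k|`. -/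
def mubEnsemble [FiniteDimensional ℂ H] (φ ψ : OrthonormalBasis (ZMod d) ℂ H) (qφ qψ : ℝ)
    (hφ : 0 < qφ) (hψ : 0 < qψ) (hq : qφ + qψ = 1) : StateEnsemble H (MubLabel d) where
  state x := ketbra (![φ, ψ] x.1 x.2) (![φ, ψ] x.1 x.2)
  state_pos x := ketbra_isPositive _
  state_trace x := ketbra_trace _ ((![φ, ψ] x.1).norm_eq_one x.2)
  prob x := ![qφ, qψ] x.1 / d
  prob_nonneg x := by
    rcases x with ⟨ℓ, h⟩
    fin_cases ℓ
    · exact div_nonneg hφ.le (Nat.cast_nonneg d)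
    · exact div_nonneg hψ.le (Nat.cast_nonneg d)
  prob_sum := by
    have hd : (d : ℝ) ≠ 0 := Nat.cast_ne_zero.mpr (NeZero.ne d)
    rw [Fintype.sum_prod_type, Fin.sum_univ_two]
    simp only [Matrix.cons_val_zero, Matrix.cons_val_one, Finset.sum_const,
      Finset.card_univ, ZMod.card, nsmul_eq_mul]
    field_simp
    exact hq

/-- The system of equations that determines the coefficients `(α, β)`. -/
def IsCoeff (d : ℕ) (qφ qψ α β : ℝ) : Prop :=
  0 < α ∧ 0 < β ∧
  α ^ 2 + β ^ 2 + 2 / Real.sqrt d * (α * β) = 1 ∧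
  α / β = Real.sqrt d / (2 * qψ) *
    (qφ - qψ + Real.sqrt ((qφ - qψ) ^ 2 + 4 / d * (qφ * qψ)))

end mub

end

end PostInfo

namespace PostInfo

noncomputable section

/-! An outcome on which the pair `(h, k)` is guessed contributes `1/d` times the trace of its effect
against `A = qφ |φ_h⟩⟨φ_h| + qψ |ψ_k⟩⟨ψ_k|`. The largest eigenvalue `l` of `A` depends only on the
weights and on the overlap `1/√d`, so it is `mubOptimum` for every pair. As the traces of the
effects sum to `d`, no strategy exceeds `l` (`IsCoeff.postGuess_le`).

The eigenvector is `v_hk = α φ_h + β ω^{-hk} ψ_k`. Instead of a spectral decomposition,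
`two_rankOne_identity` writes `l ⟨w, (l - A) w⟩` as a sum of two squares, giving the bound and its
equality case together. Hence a measurement is optimal exactly when its effects are `c(h,k)
|v_hk⟩⟨v_hk|` (`IsCoeff.postGuessProd_eq_iff`), and constant `c = 1/d` gives a measurement.

Uniqueness then asks whether the projections on the `v_hk` are linearly independent. A Fourier
transform in `k` splits a linear relation into shift equations on `ℤ_d`. For odd `d` they have only
the zero solution, since 2 is invertible; for even `d` a character `ω^{mh+nk}` with `ω^{mn} = -1`
solves them, and its real part perturbs the constant weights. -/

/-- The optimal guessing probability of two Fourier conjugate bases. -/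
def mubOptimum (d : ℕ) (qφ qψ : ℝ) : ℝ :=
  1 / 2 * (1 + Real.sqrt ((qφ - qψ) ^ 2 + 4 / d * (qφ * qψ)))

/-! ### The coefficients `α`, `β` and the eigenvalue equations -/

section coeff

theorem mubOptimum_pos (d : ℕ) (qφ qψ : ℝ) : 0 < mubOptimum d qφ qψ := by
  have := Real.sqrt_nonneg ((qφ - qψ) ^ 2 + 4 / d * (qφ * qψ))
  unfold mubOptimum
  linarith

variable {d : ℕ} [NeZero d] {qφ qψ α β : ℝ}

theorem sqrt_dim_pos (d : ℕ) [NeZero d] : 0 < Real.sqrt d :=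
  Real.sqrt_pos.2 (Nat.cast_pos.2 (NeZero.pos d))

theorem coeff_ratio_pos (hφ : 0 < qφ) (hψ : 0 < qψ) :
    0 < Real.sqrt d / (2 * qψ) *
      (qφ - qψ + Real.sqrt ((qφ - qψ) ^ 2 + 4 / d * (qφ * qψ))) := by
  have hd := sqrt_dim_pos d
  have hd' : (0 : ℝ) < d := Nat.cast_pos.2 (NeZero.pos d)
  have h : |qφ - qψ| < Real.sqrt ((qφ - qψ) ^ 2 + 4 / d * (qφ * qψ)) := by
    rw [← Real.sqrt_sq_eq_abs]
    refine Real.sqrt_lt_sqrt (sq_nonneg _) ?_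
    have : 0 < 4 / d * (qφ * qψ) := by positivity
    linarith
  have h2 := neg_abs_le (qφ - qψ)
  exact mul_pos (by positivity) (by linarith)

/-- The last equation prescribes a positive ratio `r = α/β`; the quadratic one then reads `β² (r² +
1 + 2r/√d) = 1`, which fixes the scale. -/
theorem existsUnique_isCoeff (hφ : 0 < qφ) (hψ : 0 < qψ) :
    ∃! c : ℝ × ℝ, IsCoeff d qφ qψ c.1 c.2 := by
  have hd := sqrt_dim_pos d
  have hr := coeff_ratio_pos (d := d) hφ hψ
  unfold IsCoeff
  generalize Real.sqrt d / (2 * qψ) *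
      (qφ - qψ + Real.sqrt ((qφ - qψ) ^ 2 + 4 / d * (qφ * qψ))) = r at hr
  have hN : 0 < r ^ 2 + 1 + 2 / Real.sqrt d * r := by positivity
  have hs := Real.sqrt_pos.2 hN
  have hsq := Real.sq_sqrt hN.le
  set N := Real.sqrt (r ^ 2 + 1 + 2 / Real.sqrt d * r)
  refine ⟨(r / N, 1 / N), ⟨by positivity, by positivity, ?_, ?_⟩, ?_⟩
  · have : (r / N) ^ 2 + (1 / N) ^ 2 + 2 / Real.sqrt d * (r / N * (1 / N)) =
        (r ^ 2 + 1 + 2 / Real.sqrt d * r) / N ^ 2 := by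
      field_simp
    simp only
    rw [this, hsq, div_self hN.ne']
  · simp only
    field_simp
  · rintro ⟨a, b⟩ ⟨ha, hb, h1, h2⟩
    simp only at ha hb h1 h2
    rw [div_eq_iff hb.ne'] at h2
    subst h2
    have hbN : (b * N) ^ 2 = 1 := by
      rw [mul_pow, hsq]
      linear_combination h1
    have hbN' : b * N = 1 := by
      have := mul_pos hb hs
      nlinarith
    have hb' : b = 1 / N := by
      field_simp
      exact hbN'
    rw [hb']
    ext <;> simp only
    ring

/-- With `eigen_left`, this makes `α e + β f` an eigenvector of `qφ |e⟩⟨e| + qψ |f⟩⟨f|` when `⟨e, f⟩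
= 1/√d`. This half is the ratio equation rearranged; the other half also needs the square of the
root. -/
theorem IsCoeff.eigen_right (h : IsCoeff d qφ qψ α β) (hψ : 0 < qψ) (hq : qφ + qψ = 1) :
    (mubOptimum d qφ qψ - qψ) * β = qψ * (1 / Real.sqrt d) * α := by
  obtain ⟨-, hb, -, h2⟩ := h
  have hd := sqrt_dim_pos d
  rw [div_eq_iff hb.ne'] at h2
  unfold mubOptimum
  rw [h2]
  field_simp
  linear_combination (-1) * hq

theorem IsCoeff.eigen_left (h : IsCoeff d qφ qψ α β) (hφ : 0 < qφ) (hψ : 0 < qψ)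
    (hq : qφ + qψ = 1) :
    (mubOptimum d qφ qψ - qφ) * α = qφ * (1 / Real.sqrt d) * β := by
  obtain ⟨-, hb, -, h2⟩ := h
  have hd := sqrt_dim_pos d
  have hd' : (0 : ℝ) < d := Nat.cast_pos.2 (NeZero.pos d)
  have hdd : Real.sqrt d ^ 2 = d := Real.sq_sqrt hd'.le
  have hS : Real.sqrt ((qφ - qψ) ^ 2 + 4 / d * (qφ * qψ)) ^ 2 =
      (qφ - qψ) ^ 2 + 4 / d * (qφ * qψ) := Real.sq_sqrt (by positivity)
  rw [div_eq_iff hb.ne'] at h2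
  unfold mubOptimum
  generalize Real.sqrt ((qφ - qψ) ^ 2 + 4 / d * (qφ * qψ)) = S at *
  rw [← hdd] at hS
  generalize Real.sqrt d = t at *
  rw [h2]
  obtain rfl : qφ = 1 - qψ := by linarith
  field_simp at hS ⊢
  linear_combination hS

end coeff

/-! ### A weighted sum of two rank-one projections as a quadratic form -/

section quadratic

variable {H : Type*} [NormedAddCommGroup H] [InnerProductSpace ℂ H]

/-- For `A = p |e⟩⟨e| + q |f⟩⟨f|`, this is `l(l - A) = (l - A)² + A(l - A)` evaluated at `w`. The
form of `A(l - A)` has diagonal coefficients `p(l - p)` and `q(l - q)` and a cross term `-2pqs`; the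
eigenvalue equations complete it to a single square. -/
theorem two_rankOne_identity {e f : H} {s p q l α β : ℝ} (he : ‖e‖ = 1) (hf : ‖f‖ = 1)
    (hef : (inner ℂ e f : ℂ) = s) (hα : 0 < α) (hβ : 0 < β)
    (h1 : (l - p) * α = p * s * β) (h2 : (l - q) * β = q * s * α) (w : H) :
    l * (l * ‖w‖ ^ 2 - (p * ‖(inner ℂ e w : ℂ)‖ ^ 2 + q * ‖(inner ℂ f w : ℂ)‖ ^ 2)) =
      ‖(l : ℂ) • w - ((p : ℂ) * inner ℂ e w) • e - ((q : ℂ) * inner ℂ f w) • f‖ ^ 2 +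
      s / (α * β) *
        ‖(p * β : ℂ) * inner ℂ e w - (q * α : ℂ) * inner ℂ f w‖ ^ 2 := by
  have hee : (inner ℂ e e : ℂ) = 1 := by simp [inner_self_eq_norm_sq_to_K, he]
  have hff : (inner ℂ f f : ℂ) = 1 := by simp [inner_self_eq_norm_sq_to_K, hf]
  have hfe : (inner ℂ f e : ℂ) = s := by
    rw [← inner_conj_symm, hef, Complex.conj_ofReal]
  have hwe : (inner ℂ w e : ℂ) = starRingEnd ℂ (inner ℂ e w) := (inner_conj_symm _ _).symm
  have hwf : (inner ℂ w f : ℂ) = starRingEnd ℂ (inner ℂ f w) := (inner_conj_symm _ _).symm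
  have hww : (inner ℂ w w : ℂ) = ((‖w‖ ^ 2 : ℝ) : ℂ) := by
    simp [inner_self_eq_norm_sq_to_K]
  rw [← inner_self_eq_norm_sq (𝕜 := ℂ)
    ((l : ℂ) • w - ((p : ℂ) * inner ℂ e w) • e - ((q : ℂ) * inner ℂ f w) • f)]
  simp only [inner_sub_left, inner_sub_right, inner_smul_left, inner_smul_right, hee, hff, hef,
    hfe, hwe, hwf, hww]
  generalize (inner ℂ e w : ℂ) = x
  generalize (inner ℂ f w : ℂ) = y
  generalize ‖w‖ ^ 2 = n
  simp only [← Complex.normSq_eq_norm_sq, Complex.normSq_apply]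
  simp only [map_mul, Complex.conj_ofReal, RCLike.re_eq_complex_re, Complex.sub_re,
    Complex.mul_re, Complex.mul_im, Complex.sub_im, Complex.ofReal_re, Complex.ofReal_im,
    Complex.conj_re, Complex.conj_im, Complex.one_re, Complex.one_im]
  have h1' : l = p + p * s * β / α := by field_simp; linarith
  have h2' : s * q * α ^ 2 = (l - q) * β * α := by rw [h2]; ring
  have h3 : s * p * β ^ 2 = (l - p) * α * β := by rw [h1]; ring
  field_simp
  linear_combination (-p) * (x.re ^ 2 + x.im ^ 2) * h3 - q * (y.re ^ 2 + y.im ^ 2) * h2'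

theorem two_rankOne_le {e f : H} {s p q l α β : ℝ} (he : ‖e‖ = 1) (hf : ‖f‖ = 1)
    (hef : (inner ℂ e f : ℂ) = s) (hα : 0 < α) (hβ : 0 < β) (hs : 0 < s) (hl : 0 < l)
    (h1 : (l - p) * α = p * s * β) (h2 : (l - q) * β = q * s * α) (w : H) :
    p * ‖(inner ℂ e w : ℂ)‖ ^ 2 + q * ‖(inner ℂ f w : ℂ)‖ ^ 2 ≤ l * ‖w‖ ^ 2 := by
  have h := two_rankOne_identity he hf hef hα hβ h1 h2 w
  have h3 : 0 ≤ l * (l * ‖w‖ ^ 2 - (p * ‖(inner ℂ e w : ℂ)‖ ^ 2 +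
      q * ‖(inner ℂ f w : ℂ)‖ ^ 2)) := by
    rw [h]
    positivity
  have := nonneg_of_mul_nonneg_right h3 hl
  linarith

/-- Both squares in the identity must vanish. The first puts `w` in the span of `e` and `f`, the
second makes its coefficients proportional to `α : β`. -/
theorem two_rankOne_eq {e f : H} {s p q l α β : ℝ} (he : ‖e‖ = 1) (hf : ‖f‖ = 1)
    (hef : (inner ℂ e f : ℂ) = s) (hα : 0 < α) (hβ : 0 < β) (hs : 0 < s) (hl : 0 < l)
    (h1 : (l - p) * α = p * s * β) (h2 : (l - q) * β = q * s * α) {w : H}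
    (hw : l * ‖w‖ ^ 2 ≤ p * ‖(inner ℂ e w : ℂ)‖ ^ 2 + q * ‖(inner ℂ f w : ℂ)‖ ^ 2) :
    ∃ z : ℂ, w = z • ((α : ℂ) • e + (β : ℂ) • f) := by
  have h := two_rankOne_identity he hf hef hα hβ h1 h2 w
  have hle : l * (l * ‖w‖ ^ 2 - (p * ‖(inner ℂ e w : ℂ)‖ ^ 2 +
      q * ‖(inner ℂ f w : ℂ)‖ ^ 2)) ≤ 0 :=
    mul_nonpos_of_nonneg_of_nonpos hl.le (by linarith)
  have hc : 0 < s / (α * β) := by positivity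
  have hA := sq_nonneg ‖(l : ℂ) • w - ((p : ℂ) * inner ℂ e w) • e - ((q : ℂ) * inner ℂ f w) • f‖
  have hB := mul_nonneg hc.le
    (sq_nonneg ‖(p * β : ℂ) * inner ℂ e w - (q * α : ℂ) * inner ℂ f w‖)
  have hA0 := pow_eq_zero_iff (two_ne_zero) |>.1 (le_antisymm (by linarith) hA)
  have hB0 := le_antisymm (by linarith) hB
  rw [mul_eq_zero, or_iff_right hc.ne', pow_eq_zero_iff two_ne_zero, norm_eq_zero,
    sub_eq_zero] at hB0
  rw [norm_eq_zero, sub_sub, sub_eq_zero] at hA0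
  have hlC : (l : ℂ) ≠ 0 := Complex.ofReal_ne_zero.2 hl.ne'
  have hαC : (α : ℂ) ≠ 0 := Complex.ofReal_ne_zero.2 hα.ne'
  have hβC : (β : ℂ) ≠ 0 := Complex.ofReal_ne_zero.2 hβ.ne'
  refine ⟨(l : ℂ)⁻¹ * ((p : ℂ) * inner ℂ e w / α), ?_⟩
  have : (q : ℂ) * inner ℂ f w = (p : ℂ) * inner ℂ e w / α * β := by
    field_simp
    linear_combination (-1) * hB0
  rw [mul_smul, eq_inv_smul_iff₀ hlC, hA0, this, smul_add, smul_smul, smul_smul,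
    div_mul_cancel₀ _ hαC]

theorem two_rankOne_apply {e f : H} {s p q l α β : ℝ} (he : ‖e‖ = 1) (hf : ‖f‖ = 1)
    (hef : (inner ℂ e f : ℂ) = s) (hα : 0 < α) (hβ : 0 < β) (hl : 0 < l)
    (h1 : (l - p) * α = p * s * β) (h2 : (l - q) * β = q * s * α) :
    p * ‖(inner ℂ e ((α : ℂ) • e + (β : ℂ) • f) : ℂ)‖ ^ 2 +
      q * ‖(inner ℂ f ((α : ℂ) • e + (β : ℂ) • f) : ℂ)‖ ^ 2 =
      l * ‖(α : ℂ) • e + (β : ℂ) • f‖ ^ 2 := by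
  have h := two_rankOne_identity he hf hef hα hβ h1 h2 ((α : ℂ) • e + (β : ℂ) • f)
  have hee : (inner ℂ e e : ℂ) = 1 := by simp [inner_self_eq_norm_sq_to_K, he]
  have hff : (inner ℂ f f : ℂ) = 1 := by simp [inner_self_eq_norm_sq_to_K, hf]
  have hfe : (inner ℂ f e : ℂ) = s := by
    rw [← inner_conj_symm, hef, Complex.conj_ofReal]
  have h1c : ((l : ℂ) - p) * α = p * s * β := by exact_mod_cast h1
  have h2c : ((l : ℂ) - q) * β = q * s * α := by exact_mod_cast h2
  have hx : (p : ℂ) * inner ℂ e ((α : ℂ) • e + (β : ℂ) • f) = l * α := by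
    rw [inner_add_right, inner_smul_right, inner_smul_right, hee, hef]
    linear_combination (-1) * h1c
  have hy : (q : ℂ) * inner ℂ f ((α : ℂ) • e + (β : ℂ) • f) = l * β := by
    rw [inner_add_right, inner_smul_right, inner_smul_right, hfe, hff]
    linear_combination (-1) * h2c
  have hA : (l : ℂ) • ((α : ℂ) • e + (β : ℂ) • f) -
      ((p : ℂ) * inner ℂ e ((α : ℂ) • e + (β : ℂ) • f)) • e -
      ((q : ℂ) * inner ℂ f ((α : ℂ) • e + (β : ℂ) • f)) • f = 0 := by
    rw [hx, hy]
    module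
  have hB : (p * β : ℂ) * inner ℂ e ((α : ℂ) • e + (β : ℂ) • f) -
      (q * α : ℂ) * inner ℂ f ((α : ℂ) • e + (β : ℂ) • f) = 0 := by
    linear_combination (β : ℂ) * hx - (α : ℂ) * hy
  rw [hA, hB, norm_zero, norm_zero] at h
  have := (mul_eq_zero.1 (h.trans (by ring : (0:ℝ) ^ 2 + s / (α * β) * 0 ^ 2 = 0))).resolve_left
    hl.ne'
  linarith

end quadratic

/-! ### From vectors to positive operators -/

section trace

variable {H : Type*} [NormedAddCommGroup H] [InnerProductSpace ℂ H]

theorem mul_ketbra (A : Op H) (u v : H) : A * ketbra u v = ketbra (A u) v := by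
  ext w
  simp [ketbra_apply]

theorem ketbra_smul_smul (z : ℂ) (u : H) :
    ketbra (z • u) (z • u) = ((‖z‖ ^ 2 : ℝ) : ℂ) • ketbra u u := by
  ext w
  simp only [ketbra_apply, LinearMap.smul_apply, inner_smul_left, smul_smul]
  congr 1
  rw [← Complex.normSq_eq_norm_sq, ← Complex.mul_conj]
  ring

/-- `Re tr[(p |e⟩⟨e| + q |f⟩⟨f|) T]`. -/
def pairScore (p q : ℝ) (e f : H) (T : Op H) : ℝ :=
  p * (LinearMap.trace ℂ H (ketbra e e * T)).re + q * (LinearMap.trace ℂ H (ketbra f f * T)).re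

theorem pairScore_sum (p q : ℝ) (e f : H) {ι : Type*} (s : Finset ι) (T : ι → Op H) :
    pairScore p q e f (∑ i ∈ s, T i) = ∑ i ∈ s, pairScore p q e f (T i) := by
  simp only [pairScore, Finset.mul_sum, map_sum, Complex.re_sum, Finset.sum_add_distrib]

theorem pairScore_smul (p q : ℝ) (e f : H) (c : ℝ) (T : Op H) :
    pairScore p q e f ((c : ℂ) • T) = c * pairScore p q e f T := by
  simp only [pairScore, mul_smul_comm, map_smul, smul_eq_mul, Complex.re_ofReal_mul]
  ring

variable [FiniteDimensional ℂ H]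

theorem trace_ketbra (u v : H) : LinearMap.trace ℂ H (ketbra u v) = inner ℂ v u :=
  InnerProductSpace.trace_rankOne (𝕜 := ℂ) u v

theorem re_trace_ketbra_self (u : H) : (LinearMap.trace ℂ H (ketbra u u)).re = ‖u‖ ^ 2 := by
  rw [trace_ketbra]
  exact inner_self_eq_norm_sq (𝕜 := ℂ) u

theorem re_trace_ketbra_mul_ketbra (u w : H) :
    (LinearMap.trace ℂ H (ketbra u u * ketbra w w)).re = ‖(inner ℂ u w : ℂ)‖ ^ 2 := by
  rw [mul_ketbra, trace_ketbra, ketbra_apply, inner_smul_right, ← inner_conj_symm w u,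
    Complex.mul_conj, Complex.ofReal_re, Complex.normSq_eq_norm_sq]

theorem exists_eq_sum_ketbra {T : Op H} (hT : T.IsPositive) :
    ∃ (m : ℕ) (w : Fin m → H), T = ∑ i, ketbra (w i) (w i) := by
  obtain ⟨m, w, h⟩ := ContinuousLinearMap.isPositive_iff_eq_sum_rankOne.1
    ((LinearMap.isPositive_toContinuousLinearMap_iff T).2 hT)
  refine ⟨m, w, ?_⟩
  have h2 := congrArg (fun S : H →L[ℂ] H => (S : H →ₗ[ℂ] H)) h
  simpa [ketbra] using h2

theorem pairScore_ketbra (p q : ℝ) (e f w : H) :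
    pairScore p q e f (ketbra w w) =
      p * ‖(inner ℂ e w : ℂ)‖ ^ 2 + q * ‖(inner ℂ f w : ℂ)‖ ^ 2 := by
  simp only [pairScore, re_trace_ketbra_mul_ketbra]

theorem pairScore_le {e f : H} {s p q l α β : ℝ} (he : ‖e‖ = 1) (hf : ‖f‖ = 1)
    (hef : (inner ℂ e f : ℂ) = s) (hα : 0 < α) (hβ : 0 < β) (hs : 0 < s) (hl : 0 < l)
    (h1 : (l - p) * α = p * s * β) (h2 : (l - q) * β = q * s * α) {T : Op H}
    (hT : T.IsPositive) :
    pairScore p q e f T ≤ l * (LinearMap.trace ℂ H T).re := by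
  obtain ⟨m, w, rfl⟩ := exists_eq_sum_ketbra hT
  simp only [pairScore_sum, map_sum, Complex.re_sum, Finset.mul_sum, pairScore_ketbra,
    re_trace_ketbra_self]
  exact Finset.sum_le_sum fun i _ => two_rankOne_le he hf hef hα hβ hs hl h1 h2 (w i)

/-- In a decomposition of `T` into rank-one terms each term obeys the bound, so equality in total
forces equality for each, and every vector is a multiple of the same eigenvector. -/
theorem exists_eq_smul_of_pairScore_eq {e f : H} {s p q l α β : ℝ} (he : ‖e‖ = 1)
    (hf : ‖f‖ = 1) (hef : (inner ℂ e f : ℂ) = s) (hα : 0 < α) (hβ : 0 < β) (hs : 0 < s)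
    (hl : 0 < l)
    (h1 : (l - p) * α = p * s * β) (h2 : (l - q) * β = q * s * α) {T : Op H}
    (hT : T.IsPositive) (hTe : pairScore p q e f T = l * (LinearMap.trace ℂ H T).re) :
    ∃ c : ℝ, T = (c : ℂ) • ketbra ((α : ℂ) • e + (β : ℂ) • f) ((α : ℂ) • e + (β : ℂ) • f) := by
  obtain ⟨m, w, rfl⟩ := exists_eq_sum_ketbra hT
  simp only [pairScore_sum, map_sum, Complex.re_sum, Finset.mul_sum, pairScore_ketbra,
    re_trace_ketbra_self] at hTe
  have hw := (Finset.sum_eq_sum_iff_of_le fun i _ =>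
    two_rankOne_le he hf hef hα hβ hs hl h1 h2 (w i)).1 hTe
  choose z hz using fun i =>
    two_rankOne_eq he hf hef hα hβ hs hl h1 h2 (hw i (Finset.mem_univ i)).ge
  refine ⟨∑ i, ‖z i‖ ^ 2, ?_⟩
  rw [Complex.ofReal_sum, Finset.sum_smul]
  refine Finset.sum_congr rfl fun i _ => ?_
  rw [← ketbra_smul_smul, ← hz i]

end trace

/-! ### The guessing probability as a sum over outcomes -/

section reindex

variable {H : Type*} [NormedAddCommGroup H] [InnerProductSpace ℂ H]
  {X I : Type*} [Fintype X] [DecidableEq X] [Fintype I]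

/-- The weight of each part cancels the normalisation of its subensemble, and summing over the
fibres of `f ℓ` is summing over outcomes. -/
theorem postGuess_eq_sum (E : StateEnsemble H X) (P : LabelPartition X I)
    (hE : ∀ ℓ, E.partProb P ℓ ≠ 0) {Y : Type*} [Fintype Y]
    (M : Measurement H Y) (f : ∀ ℓ, Y → P.Part ℓ) :
    postGuess E P M f =
      ∑ y, ∑ ℓ, (LinearMap.trace ℂ H (E.op (f ℓ y) * M.effect y)).re := by
  rw [Finset.sum_comm]
  refine Finset.sum_congr rfl fun ℓ _ => ?_
  rw [guessProb, Finset.mul_sum, ← Finset.sum_fiberwise Finset.univ (f ℓ)]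
  refine Finset.sum_congr rfl fun x _ => ?_
  simp only [StateEnsemble.sub, Measurement.pushforward, smul_mul_assoc, map_smul, smul_eq_mul,
    ← Complex.ofReal_inv, Complex.re_ofReal_mul, Finset.mul_sum, map_sum, Complex.re_sum]
  refine Finset.sum_congr rfl fun y hy => ?_
  rw [(Finset.mem_filter.1 hy).2, mul_inv_cancel_left₀ (hE ℓ)]

theorem Measurement.sum_re_trace [FiniteDimensional ℂ H] {Y : Type*} [Fintype Y]
    (M : Measurement H Y) :
    ∑ y, (LinearMap.trace ℂ H (M.effect y)).re = Module.finrank ℂ H := by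
  rw [← Complex.re_sum, ← map_sum, M.sum_eq_one, LinearMap.trace_one, Complex.natCast_re]

end reindex

/-! ### Characters of `ℤ_d` -/

section omega

variable {d : ℕ} [NeZero d]

theorem omegaPow_add (x y : ZMod d) : omegaPow (x + y) = omegaPow x * omegaPow y :=
  AddChar.map_add_eq_mul _ x y

theorem omegaPow_zero : omegaPow (0 : ZMod d) = 1 :=
  AddChar.map_zero_eq_one _

theorem norm_omegaPow (x : ZMod d) : ‖omegaPow x‖ = 1 := by
  rw [omegaPow, ZMod.stdAddChar_apply, Circle.norm_coe]

theorem conj_omegaPow (x : ZMod d) : starRingEnd ℂ (omegaPow x) = omegaPow (-x) := by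
  have h : omegaPow x * omegaPow (-x) = 1 := by
    rw [← omegaPow_add, add_neg_cancel, omegaPow_zero]
  have h2 : omegaPow x * starRingEnd ℂ (omegaPow x) = 1 := by
    rw [Complex.mul_conj, Complex.normSq_eq_norm_sq, norm_omegaPow]
    simp
  exact mul_left_cancel₀ (left_ne_zero_of_mul_eq_one h) (h2.trans h.symm)

theorem sum_omegaPow_mul (t : ZMod d) :
    ∑ k, omegaPow (t * k) = if t = 0 then (d : ℂ) else 0 := by
  have h := AddChar.sum_mulShift t (ZMod.isPrimitive_stdAddChar d)
  rw [ZMod.card] at h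
  simp only [omegaPow, mul_comm t, h]
  split_ifs <;> simp

theorem eq_zero_of_sum_mul_omegaPow_eq_zero {e : ZMod d → ℂ}
    (h : ∀ t, ∑ k, e k * omegaPow (t * k) = 0) : e = 0 := by
  refine (ZMod.dft (N := d) (E := ℂ)).injective ?_
  rw [map_zero]
  ext t
  rw [ZMod.dft_apply, Pi.zero_apply, ← h (-t)]
  refine Finset.sum_congr rfl fun k _ => ?_
  rw [smul_eq_mul, mul_comm, omegaPow]
  congr 2
  ring

end omega

/-! ### Matrix elements of the projections on the eigenvectors -/

section tilt

variable {d : ℕ} [NeZero d] {H : Type*} [NormedAddCommGroup H] [InnerProductSpace ℂ H]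

/-- The vector `α φ_h + β ω^{-hk} ψ_k`. -/
def tilt (φ ψ : OrthonormalBasis (ZMod d) ℂ H) (α β : ℝ) (h k : ZMod d) : H :=
  (α : ℂ) • φ h + (β : ℂ) • omegaPow (-(h * k)) • ψ k

variable {φ ψ : OrthonormalBasis (ZMod d) ℂ H}

theorem IsFourierConjugate.inner_eq (hφψ : IsFourierConjugate φ ψ) (a k : ZMod d) :
    (inner ℂ (φ a) (ψ k) : ℂ) = ((1 / Real.sqrt d : ℝ) : ℂ) * omegaPow (a * k) := by
  rw [hφψ k, inner_smul_right, inner_sum]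
  congr 1
  simp [inner_smul_right, orthonormal_iff_ite.1 φ.orthonormal]

theorem IsFourierConjugate.inner_phase (hφψ : IsFourierConjugate φ ψ) (a h k : ZMod d) :
    (inner ℂ (φ a) (omegaPow (-(h * k)) • ψ k) : ℂ) =
      ((1 / Real.sqrt d : ℝ) : ℂ) * omegaPow ((a - h) * k) := by
  rw [inner_smul_right, hφψ.inner_eq, mul_left_comm, ← omegaPow_add]
  congr 2
  ring

theorem norm_phase (ψ : OrthonormalBasis (ZMod d) ℂ H) (z k : ZMod d) :
    ‖omegaPow z • ψ k‖ = 1 := by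
  rw [norm_smul, norm_omegaPow, ψ.norm_eq_one, one_mul]

theorem ketbra_phase (z : ZMod d) (u : H) :
    ketbra (omegaPow z • u) (omegaPow z • u) = ketbra u u := by
  rw [ketbra_smul_smul, norm_omegaPow]
  simp

theorem IsFourierConjugate.inner_tilt (hφψ : IsFourierConjugate φ ψ) (α β : ℝ)
    (a h k : ZMod d) :
    (inner ℂ (φ a) (tilt φ ψ α β h k) : ℂ) =
      α * (if a = h then 1 else 0) +
        β * ((1 / Real.sqrt d : ℝ) : ℂ) * omegaPow ((a - h) * k) := by
  rw [tilt, inner_add_right, inner_smul_right, inner_smul_right, hφψ.inner_phase,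
    orthonormal_iff_ite.1 φ.orthonormal, mul_assoc]

/-- The point of this form is that `k` enters only through the character `ω^{(a-b)k}`, so sums over
`k` become Fourier transforms at `a - b`. -/
theorem IsFourierConjugate.inner_ketbra_tilt (hφψ : IsFourierConjugate φ ψ) (α β : ℝ)
    (a b h k : ZMod d) :
    (inner ℂ (φ a) (ketbra (tilt φ ψ α β h k) (tilt φ ψ α β h k) (φ b)) : ℂ) =
      (α ^ 2 * (if a = b then 1 else 0) * (if a = h then 1 else 0) +
        α * β * ((1 / Real.sqrt d : ℝ) : ℂ) *
          ((if a = h then 1 else 0) + (if b = h then 1 else 0)) +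
        β ^ 2 * ((1 / Real.sqrt d : ℝ) : ℂ) ^ 2) * omegaPow ((a - b) * k) := by
  rw [ketbra_apply, inner_smul_right, ← inner_conj_symm _ (φ b), hφψ.inner_tilt, hφψ.inner_tilt]
  have h1 : omegaPow (-((b - h) * k)) * omegaPow ((a - h) * k) = omegaPow ((a - b) * k) := by
    rw [← omegaPow_add]
    congr 1
    ring
  simp only [map_add, map_mul, Complex.conj_ofReal, conj_omegaPow]
  rw [apply_ite (starRingEnd ℂ), map_one, map_zero]
  by_cases hah : a = h
  · subst hah
    by_cases hba : b = a
    · subst hba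
      simp [omegaPow_zero]
      ring
    · have : omegaPow (-((b - a) * k)) = omegaPow ((a - b) * k) := by congr 1; ring
      simp [hba, Ne.symm hba, omegaPow_zero, this]
      ring
  · by_cases hbh : b = h
    · subst hbh
      simp [hah, omegaPow_zero]
      ring
    · simp only [if_neg hah, if_neg hbh]
      linear_combination (β * ((1 / Real.sqrt d : ℝ) : ℂ)) ^ 2 * h1

/-- The matrix elements of a combination of the projections on the vectors `tilt φ ψ α β h k`,
in terms of the partial Fourier transform of its coefficients. -/
theorem IsFourierConjugate.inner_sum_ketbra_tilt (hφψ : IsFourierConjugate φ ψ) (α β : ℝ)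
    (c : ZMod d → ZMod d → ℂ) (a b : ZMod d) :
    (inner ℂ (φ a) ((∑ h, ∑ k, c h k • ketbra (tilt φ ψ α β h k) (tilt φ ψ α β h k)) (φ b)) : ℂ) =
      α ^ 2 * (if a = b then 1 else 0) * ∑ k, c a k * omegaPow ((a - b) * k) +
        α * β * ((1 / Real.sqrt d : ℝ) : ℂ) *
          (∑ k, c a k * omegaPow ((a - b) * k) + ∑ k, c b k * omegaPow ((a - b) * k)) +
        β ^ 2 * ((1 / Real.sqrt d : ℝ) : ℂ) ^ 2 * ∑ h, ∑ k, c h k * omegaPow ((a - b) * k) := by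
  have key : ∀ h, ∑ k, c h k * (inner ℂ (φ a)
      (ketbra (tilt φ ψ α β h k) (tilt φ ψ α β h k) (φ b)) : ℂ) =
      (α ^ 2 * (if a = b then 1 else 0) * (if a = h then 1 else 0) +
        α * β * ((1 / Real.sqrt d : ℝ) : ℂ) *
          ((if a = h then 1 else 0) + (if b = h then 1 else 0)) +
        β ^ 2 * ((1 / Real.sqrt d : ℝ) : ℂ) ^ 2) * ∑ k, c h k * omegaPow ((a - b) * k) := by
    intro h
    rw [Finset.mul_sum]
    refine Finset.sum_congr rfl fun k _ => ?_
    rw [hφψ.inner_ketbra_tilt]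
    ring
  simp only [LinearMap.sum_apply, LinearMap.smul_apply, inner_sum, inner_smul_right]
  rw [Finset.sum_congr rfl fun h _ => key h]
  simp only [add_mul, mul_add, Finset.sum_add_distrib, mul_assoc, ite_mul, one_mul, zero_mul,
    mul_ite, mul_zero, Finset.sum_ite_eq, Finset.mem_univ, if_true, ← Finset.mul_sum]

theorem OrthonormalBasis.op_ext (φ : OrthonormalBasis (ZMod d) ℂ H) {S T : Op H}
    (h : ∀ a b, (inner ℂ (φ a) (S (φ b)) : ℂ) = inner ℂ (φ a) (T (φ b))) : S = T := by
  refine φ.toBasis.ext fun b => InnerProductSpace.ext_inner_left_basis φ.toBasis fun a => ?_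
  simpa using h a b

end tilt

/-! ### Covariance under the generalized Pauli operators -/

section weyl

variable {d : ℕ} [NeZero d] {H : Type*} [NormedAddCommGroup H] [InnerProductSpace ℂ H]
  {φ ψ : OrthonormalBasis (ZMod d) ℂ H}

theorem weyl_apply_basis (φ : OrthonormalBasis (ZMod d) ℂ H) (r s z : ZMod d) :
    weyl φ r s (φ z) = omegaPow (s * z) • φ (r + z) := by
  simp [weyl, ketbra_apply, orthonormal_iff_ite.1 φ.orthonormal]

theorem IsFourierConjugate.weyl_tilt (hφψ : IsFourierConjugate φ ψ) (α β : ℝ) (h k : ZMod d) :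
    weyl φ h k ((α : ℂ) • φ 0 + (β : ℂ) • ψ 0) = tilt φ ψ α β h k := by
  rw [tilt, map_add, map_smul, map_smul, weyl_apply_basis, mul_zero, omegaPow_zero, one_smul,
    add_zero, hφψ 0, hφψ k, smul_comm (omegaPow _), map_smul, map_sum]
  congr 3
  -- The shift of the summation index by `h` produces the phase `ω^{-hk}`.
  rw [Finset.smul_sum,
    ← Equiv.sum_comp (Equiv.addLeft h) fun z => omegaPow (-(h * k)) • omegaPow (z * k) • φ z]
  refine Finset.sum_congr rfl fun z _ => ?_
  rw [mul_zero, omegaPow_zero, one_smul, weyl_apply_basis, smul_smul, ← omegaPow_add,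
    Equiv.coe_addLeft]
  congr 2
  ring

theorem mul_ketbra_mul_adjoint [FiniteDimensional ℂ H] (A : Op H) (u v : H) :
    A * ketbra u v * LinearMap.adjoint A = ketbra (A u) (A v) := by
  ext w
  simp [ketbra_apply, LinearMap.adjoint_inner_right]

end weyl

/-! ### Linear relations among the projections -/

section span

variable {d : ℕ} [NeZero d] {H : Type*} [NormedAddCommGroup H] [InnerProductSpace ℂ H]
  {φ ψ : OrthonormalBasis (ZMod d) ℂ H} {α β : ℝ}

theorem dim_mul_inv_sqrt_sq (d : ℕ) [NeZero d] :
    (d : ℂ) * ((1 / Real.sqrt d : ℝ) : ℂ) ^ 2 = 1 := by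
  have hd : (0 : ℝ) < d := Nat.cast_pos.2 (NeZero.pos d)
  have h : (d : ℝ) * (1 / Real.sqrt d) ^ 2 = 1 := by
    rw [div_pow, Real.sq_sqrt hd.le]
    field_simp
  exact_mod_cast h

/-- Constant weights have a Fourier transform supported at `a = b`, and the diagonal entries are the
normalisation of `α`, `β`. -/
theorem IsFourierConjugate.sum_ketbra_tilt_eq_one (hφψ : IsFourierConjugate φ ψ)
    (hn : α ^ 2 + β ^ 2 + 2 / Real.sqrt d * (α * β) = 1) :
    ∑ h, ∑ k, (1 / d : ℂ) • ketbra (tilt φ ψ α β h k) (tilt φ ψ α β h k) = 1 := by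
  have hdC : (d : ℂ) ≠ 0 := Nat.cast_ne_zero.2 (NeZero.ne d)
  refine OrthonormalBasis.op_ext φ fun a b => ?_
  rw [hφψ.inner_sum_ketbra_tilt, ← Finset.mul_sum, sum_omegaPow_mul, Module.End.one_apply,
    orthonormal_iff_ite.1 φ.orthonormal]
  simp only [sub_eq_zero, Finset.sum_const, Finset.card_univ, ZMod.card, nsmul_eq_mul]
  have hd := dim_mul_inv_sqrt_sq d
  have hn' : (α : ℂ) ^ 2 + β ^ 2 + 2 * ((1 / Real.sqrt d : ℝ) : ℂ) * (α * β) = 1 := by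
    have h := congrArg Complex.ofReal hn
    push_cast at h ⊢
    linear_combination h
  split_ifs with hab
  · rw [one_div_mul_cancel hdC]
    linear_combination hn' + (β : ℂ) ^ 2 * hd
  · ring

/-- If `x` is annihilated by `x_a ↦ x_a + x_{a-t} + c ∑ x`, it vanishes, for `d` odd. -/
theorem eq_zero_of_odd_of_add_shift (hd : Odd d) {t : ZMod d} {r : ℝ} (hr : 0 < r)
    {x : ZMod d → ℂ} (h : ∀ a, x a + x (a - t) + r * ∑ b, x b = 0) : x = 0 := by
  obtain ⟨m, hm⟩ := hd
  -- Subtracting the relations at `a` and `a - t` shows that `x` has period `2t`.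
  have h2 : ∀ a, x (a - (t + t)) = x a := fun a => by
    have h1 := h a
    have h1' := h (a - t)
    rw [sub_sub] at h1'
    linear_combination h1' - h1
  have h3 : ∀ (n : ℕ) a, x (a - n * (t + t)) = x a := by
    intro n
    induction n with
    | zero => simp
    | succ n ih =>
      intro a
      rw [← ih a, ← h2 (a - n * (t + t))]
      congr 1
      push_cast
      ring
  -- For `d = 2m + 1`, `m + 1` is the inverse of 2, so period `2t` implies period `t`; the relation
  -- then makes `x` constant.
  have ht : ((m + 1 : ℕ) : ZMod d) * (t + t) = t := by
    have hd0 : ((2 * m + 1 : ℕ) : ZMod d) = 0 := by rw [← hm, ZMod.natCast_self]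
    push_cast at hd0 ⊢
    linear_combination t * hd0
  have h4 : ∀ a, x a = -(r * ∑ b, x b) / 2 := fun a => by
    have h1 := h a
    have h5 := h3 (m + 1) a
    rw [ht] at h5
    rw [h5] at h1
    linear_combination h1 / 2
  have hS : (∑ b, x b) * (1 + r * d / 2 : ℝ) = 0 := by
    have : ∑ b, x b = d * (-(r * ∑ b, x b) / 2) := by
      conv_lhs => rw [Finset.sum_congr rfl fun a _ => h4 a]
      simp
    push_cast
    linear_combination this
  have hne : ((1 + r * d / 2 : ℝ) : ℂ) ≠ 0 := Complex.ofReal_ne_zero.2 (by positivity)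
  have hS0 := (mul_eq_zero.1 hS).resolve_right hne
  ext a
  rw [h4 a, hS0]
  simp

theorem eq_zero_of_add_sum {r : ℝ} (hr : 0 < r)
    {x : ZMod d → ℂ} (h : ∀ a, x a + r * ∑ b, x b = 0) : x = 0 := by
  have hS : (∑ b, x b) * (1 + r * d : ℝ) = 0 := by
    have : ∑ b, (x b + r * ∑ b, x b) = 0 := Finset.sum_eq_zero fun a _ => h a
    rw [Finset.sum_add_distrib] at this
    simp at this
    push_cast
    linear_combination this
  have hne : ((1 + r * d : ℝ) : ℂ) ≠ 0 := Complex.ofReal_ne_zero.2 (by positivity)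
  have hS0 := (mul_eq_zero.1 hS).resolve_right hne
  ext a
  have := h a
  rw [hS0] at this
  simpa using this

/-- The entries `(a, a - t)` involve only the transform of `c` at frequency `t`, so the frequencies
decouple. Oddness is needed only for `t ≠ 0`; the diagonal entries settle `t = 0`. -/
theorem IsFourierConjugate.eq_zero_of_sum_ketbra_tilt (hφψ : IsFourierConjugate φ ψ)
    (hα : 0 < α) (hβ : 0 < β) (hd : Odd d) {c : ZMod d → ZMod d → ℂ}
    (hc : ∑ h, ∑ k, c h k • ketbra (tilt φ ψ α β h k) (tilt φ ψ α β h k) = 0) : c = 0 := by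
  have hs : 0 < 1 / Real.sqrt d := one_div_pos.2 (sqrt_dim_pos d)
  have key := fun a b => (hφψ.inner_sum_ketbra_tilt α β c a b).symm
  simp only [hc, LinearMap.zero_apply, inner_zero_right] at key
  generalize 1 / Real.sqrt d = s at hs key
  have hα' : (α : ℂ) ≠ 0 := Complex.ofReal_ne_zero.2 hα.ne'
  have hβ' : (β : ℂ) ≠ 0 := Complex.ofReal_ne_zero.2 hβ.ne'
  have hs' : (s : ℂ) ≠ 0 := Complex.ofReal_ne_zero.2 hs.ne'
  have hx : ∀ t, (fun h => ∑ k, c h k * omegaPow (t * k)) = 0 := by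
    intro t
    by_cases ht : t = 0
    · subst ht
      obtain ⟨N, hN⟩ : ∃ N : ℝ, N = α ^ 2 + 2 * (α * β * s) := ⟨_, rfl⟩
      have hN0 : 0 < N := by rw [hN]; positivity
      have hNC : (N : ℂ) ≠ 0 := Complex.ofReal_ne_zero.2 hN0.ne'
      have hN' : (N : ℂ) = α ^ 2 + 2 * (α * β * s) := by rw [hN]; push_cast; ring
      refine eq_zero_of_add_sum (r := β ^ 2 * s ^ 2 / N) (by positivity) fun a => ?_
      have h := key a a
      rw [sub_self, if_pos rfl] at h
      push_cast
      field_simp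
      linear_combination h + (∑ k, c a k * omegaPow (0 * k)) * hN'
    · refine eq_zero_of_odd_of_add_shift hd (t := t) (r := β * s / α) (by positivity)
        fun a => ?_
      have h := key a (a - t)
      rw [sub_sub_cancel, if_neg fun h => ht (sub_eq_self.1 h.symm)] at h
      have h' : (α * β * s : ℂ) * (∑ k, c a k * omegaPow (t * k) +
          ∑ k, c (a - t) k * omegaPow (t * k) +
          (β * s / α) * ∑ h, ∑ k, c h k * omegaPow (t * k)) = 0 := by
        rw [← h]
        field_simp
        ring
      push_cast
      exact (mul_eq_zero.1 h').resolve_left (mul_ne_zero (mul_ne_zero hα' hβ') hs')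
  ext h k
  exact congrFun (eq_zero_of_sum_mul_omegaPow_eq_zero fun t => congrFun (hx t) h) k

/-- The transform of the character lives on `b = a + n`, off the diagonal since `n ≠ 0`. There the
contributions of rows `a` and `b` differ by the factor `ω^{mn} = -1` and cancel, and the full sum
over `h` vanishes since `m ≠ 0`. -/
theorem IsFourierConjugate.sum_omegaPow_ketbra_tilt (hφψ : IsFourierConjugate φ ψ) (α β : ℝ)
    {m n : ZMod d} (hmn : omegaPow (m * n) = -1) :
    ∑ h, ∑ k, omegaPow (m * h + n * k) •
      ketbra (tilt φ ψ α β h k) (tilt φ ψ α β h k) = 0 := by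
  have hone : (1 : ℂ) ≠ -1 := by norm_num
  have hm : m ≠ 0 := by
    rintro rfl
    rw [zero_mul, omegaPow_zero] at hmn
    exact hone hmn
  have hn : n ≠ 0 := by
    rintro rfl
    rw [mul_zero, omegaPow_zero] at hmn
    exact hone hmn
  refine OrthonormalBasis.op_ext φ fun a b => ?_
  rw [hφψ.inner_sum_ketbra_tilt, LinearMap.zero_apply, inner_zero_right]
  have he : ∀ h, ∑ k, omegaPow (m * h + n * k) * omegaPow ((a - b) * k) =
      omegaPow (m * h) * if n + (a - b) = 0 then (d : ℂ) else 0 := by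
    intro h
    rw [← sum_omegaPow_mul, Finset.mul_sum]
    refine Finset.sum_congr rfl fun k _ => ?_
    rw [← omegaPow_add, ← omegaPow_add]
    congr 1
    ring
  simp only [he, ← Finset.sum_mul, sum_omegaPow_mul, if_neg hm]
  split_ifs with hab hnab
  · exact absurd (by simpa [hab] using hnab) hn
  · ring
  · obtain rfl : b = a + n := by linear_combination (-1 : ZMod d) * (by assumption : n + (a - b) = 0)
    rw [mul_add m a n, omegaPow_add, hmn]
    ring
  · ring

theorem exists_omegaPow_eq_neg_one (hd : ¬ Odd d) : ∃ m : ZMod d, omegaPow m = -1 := by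
  obtain ⟨m, hm⟩ := Nat.not_odd_iff_even.1 hd
  have hm0 : (m : ℂ) ≠ 0 := by
    have := NeZero.ne d
    exact Nat.cast_ne_zero.2 (by omega)
  refine ⟨(m : ZMod d), ?_⟩
  rw [omegaPow_natCast, ← Complex.exp_nat_mul, ← Complex.exp_pi_mul_I]
  congr 1
  have : (d : ℂ) = m + m := by exact_mod_cast hm
  rw [this]
  field_simp
  ring

theorem IsFourierConjugate.sum_re_omegaPow_ketbra_tilt (hφψ : IsFourierConjugate φ ψ) (α β : ℝ)
    {m n : ZMod d} (hmn : omegaPow (m * n) = -1) :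
    ∑ h, ∑ k, ((omegaPow (m * h + n * k)).re : ℂ) •
      ketbra (tilt φ ψ α β h k) (tilt φ ψ α β h k) = 0 := by
  have h1 := hφψ.sum_omegaPow_ketbra_tilt α β hmn
  have h2 := hφψ.sum_omegaPow_ketbra_tilt α β (m := -m) (n := -n) (by rwa [neg_mul_neg])
  have h3 : ∀ h k : ZMod d, ((omegaPow (m * h + n * k)).re : ℂ) =
      (1 / 2) * omegaPow (m * h + n * k) + (1 / 2) * omegaPow (-m * h + -n * k) := by
    intro h k
    rw [Complex.re_eq_add_conj, conj_omegaPow]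
    have : -(m * h + n * k) = -m * h + -n * k := by ring
    rw [this]
    ring
  simp only [h3, add_smul, mul_smul, Finset.sum_add_distrib, ← Finset.smul_sum, h1, h2,
    smul_zero, add_zero]

end span

/-! ### Optimal measurements -/

section measurement

variable {d : ℕ} [NeZero d]

/-- The Cartesian product `X_φ × X_ψ`, identified with the pairs of labels. -/
def mubPairEquiv (d : ℕ) [NeZero d] :
    ZMod d × ZMod d ≃ (∀ ℓ, (mubPartition d).Part ℓ) where
  toFun x := mubPair x.1 x.2
  invFun x := ((x 0).1.2, (x 1).1.2)
  left_inv x := rfl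
  right_inv x := by
    funext ℓ
    have h : (x ℓ).1.1 = ℓ := (Finset.mem_filter.1 (x ℓ).2).2
    refine Subtype.ext (Prod.ext h.symm ?_)
    fin_cases ℓ <;> rfl

theorem sum_mubPair {A : Type*} [AddCommMonoid A] (g : (∀ ℓ, (mubPartition d).Part ℓ) → A) :
    ∑ x, g x = ∑ h, ∑ k, g (mubPair h k) := by
  rw [← (mubPairEquiv d).sum_comp, Fintype.sum_prod_type]
  rfl

variable {H : Type*} [NormedAddCommGroup H] [InnerProductSpace ℂ H]

theorem Measurement.ext_mubPair {C C' : Measurement H (∀ ℓ, (mubPartition d).Part ℓ)}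
    (h : ∀ h k, C.effect (mubPair h k) = C'.effect (mubPair h k)) : C = C' := by
  refine Measurement.ext (funext fun x => ?_)
  obtain ⟨y, rfl⟩ := (mubPairEquiv d).surjective x
  exact h y.1 y.2

/-- The measurement with effects `c(h,k) |u_{hk}⟩⟨u_{hk}|`. -/
def rankOneMeasurement (u : ZMod d → ZMod d → H) (c : ZMod d → ZMod d → ℝ)
    (hc : ∀ h k, 0 ≤ c h k) (hsum : ∑ h, ∑ k, (c h k : ℂ) • ketbra (u h k) (u h k) = 1) :
    Measurement H (∀ ℓ, (mubPartition d).Part ℓ) where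
  effect x := (c (x 0).1.2 (x 1).1.2 : ℂ) •
    ketbra (u (x 0).1.2 (x 1).1.2) (u (x 0).1.2 (x 1).1.2)
  pos x := (ketbra_isPositive _).smul_of_nonneg (Complex.zero_le_real.2 (hc _ _))
  sum_eq_one := by rw [sum_mubPair]; exact hsum

theorem rankOneMeasurement_effect (u : ZMod d → ZMod d → H) (c : ZMod d → ZMod d → ℝ)
    (hc : ∀ h k, 0 ≤ c h k) (hsum : ∑ h, ∑ k, (c h k : ℂ) • ketbra (u h k) (u h k) = 1)
    (h k : ZMod d) :
    (rankOneMeasurement u c hc hsum).effect (mubPair h k) =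
      (c h k : ℂ) • ketbra (u h k) (u h k) := rfl

variable {φ ψ : OrthonormalBasis (ZMod d) ℂ H} {qφ qψ α β : ℝ}

theorem finrank_eq_dim (φ : OrthonormalBasis (ZMod d) ℂ H) : Module.finrank ℂ H = d := by
  rw [Module.finrank_eq_card_basis φ.toBasis, ZMod.card]

theorem pairScore_phase (p q : ℝ) (e f : H) (z : ZMod d) (T : Op H) :
    pairScore p q e (omegaPow z • f) T = pairScore p q e f T := by
  rw [pairScore, pairScore, ketbra_phase]

/-- The phase is chosen to make the overlap real and positive, as the two-vector lemmas require; it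
leaves the projection on `ψ_k` unchanged. -/
theorem IsFourierConjugate.inner_phase_self (hφψ : IsFourierConjugate φ ψ) (h k : ZMod d) :
    (inner ℂ (φ h) (omegaPow (-(h * k)) • ψ k) : ℂ) = ((1 / Real.sqrt d : ℝ) : ℂ) := by
  rw [hφψ.inner_phase, sub_self, zero_mul, omegaPow_zero, mul_one]

theorem IsCoeff.tilt_ne_zero (hc : IsCoeff d qφ qψ α β) (hφψ : IsFourierConjugate φ ψ)
    (h k : ZMod d) : tilt φ ψ α β h k ≠ 0 := by
  intro h0
  have h1 := hφψ.inner_tilt α β h h k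
  have h2 : (0 : ℝ) < α + β * (1 / Real.sqrt d) :=
    add_pos hc.1 (mul_pos hc.2.1 (one_div_pos.2 (sqrt_dim_pos d)))
  rw [h0, inner_zero_right, if_pos rfl, sub_self, zero_mul, omegaPow_zero, mul_one, mul_one] at h1
  exact h2.ne (by exact_mod_cast h1)

/-- The measurement with effects `d⁻¹ |v⟩⟨v|`, `v = α φ_h + β ω^{-hk} ψ_k`. -/
def IsCoeff.measurement (hc : IsCoeff d qφ qψ α β) (hφψ : IsFourierConjugate φ ψ) :
    Measurement H (∀ ℓ, (mubPartition d).Part ℓ) :=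
  rankOneMeasurement (tilt φ ψ α β) (fun _ _ => 1 / d) (fun _ _ => by positivity) (by
    push_cast
    exact hφψ.sum_ketbra_tilt_eq_one hc.2.2.1)

theorem IsCoeff.measurement_effect (hc : IsCoeff d qφ qψ α β) (hφψ : IsFourierConjugate φ ψ)
    (h k : ZMod d) : (hc.measurement hφψ).effect (mubPair h k) =
      ((1 / d : ℝ) : ℂ) • ketbra (tilt φ ψ α β h k) (tilt φ ψ α β h k) := rfl

theorem IsCoeff.eq_measurement_of_odd (hc : IsCoeff d qφ qψ α β) (hφψ : IsFourierConjugate φ ψ)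
    (hd : Odd d) {C : Measurement H (∀ ℓ, (mubPartition d).Part ℓ)}
    (hC : ∀ h k, ∃ c : ℝ, C.effect (mubPair h k) =
        (c : ℂ) • ketbra (tilt φ ψ α β h k) (tilt φ ψ α β h k)) :
    C = hc.measurement hφψ := by
  choose c hC using hC
  have h1 := C.sum_eq_one
  have h2 := (hc.measurement hφψ).sum_eq_one
  rw [sum_mubPair] at h1 h2
  simp only [hC] at h1
  simp only [hc.measurement_effect hφψ] at h2
  have h3 : (fun h k => (c h k : ℂ) - ((1 / d : ℝ) : ℂ)) = 0 :=
    hφψ.eq_zero_of_sum_ketbra_tilt hc.1 hc.2.1 hd (by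
      simp only [sub_smul, Finset.sum_sub_distrib]
      rw [h1, h2, sub_self])
  refine Measurement.ext_mubPair fun h k => ?_
  rw [hC, hc.measurement_effect, sub_eq_zero.1 (congrFun (congrFun h3 h) k)]

variable [FiniteDimensional ℂ H] {hφ : 0 < qφ} {hψ : 0 < qψ} {hq : qφ + qψ = 1}

theorem mubEnsemble_partProb (ℓ : Fin 2) :
    (mubEnsemble φ ψ qφ qψ hφ hψ hq).partProb (mubPartition d) ℓ = ![qφ, qψ] ℓ := by
  have hd : (d : ℝ) ≠ 0 := Nat.cast_ne_zero.mpr (NeZero.ne d)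
  rw [StateEnsemble.partProb, mubPartition, Finset.sum_filter, Fintype.sum_prod_type]
  simp only [mubEnsemble]
  fin_cases ℓ <;> simp <;> field_simp

theorem mubEnsemble_op (ℓ : Fin 2) (x : (mubPartition d).Part ℓ) :
    (mubEnsemble φ ψ qφ qψ hφ hψ hq).op x =
      ((![qφ, qψ] ℓ / d : ℝ) : ℂ) • ketbra (![φ, ψ] ℓ x.1.2) (![φ, ψ] ℓ x.1.2) := by
  have h : x.1.1 = ℓ := (Finset.mem_filter.1 x.2).2
  simp only [StateEnsemble.op, mubEnsemble, h]

theorem postGuess_mubEnsemble {Y : Type*} [Fintype Y] (M : Measurement H Y)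
    (f : ∀ ℓ, Y → (mubPartition d).Part ℓ) :
    postGuess (mubEnsemble φ ψ qφ qψ hφ hψ hq) (mubPartition d) M f =
      (1 / d) * ∑ y, pairScore qφ qψ (φ (f 0 y).1.2) (ψ (f 1 y).1.2) (M.effect y) := by
  rw [postGuess_eq_sum, Finset.mul_sum]
  · refine Finset.sum_congr rfl fun y _ => ?_
    simp only [mubEnsemble_op, Fin.sum_univ_two, pairScore, smul_mul_assoc, map_smul, smul_eq_mul,
      Complex.re_ofReal_mul, Matrix.cons_val_zero, Matrix.cons_val_one]
    ring
  · intro ℓ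
    rw [mubEnsemble_partProb]
    fin_cases ℓ
    · exact hφ.ne'
    · exact hψ.ne'

theorem postGuessProd_mubEnsemble (C : Measurement H (∀ ℓ, (mubPartition d).Part ℓ)) :
    postGuessProd (mubEnsemble φ ψ qφ qψ hφ hψ hq) (mubPartition d) C =
      (1 / d) * ∑ h, ∑ k, pairScore qφ qψ (φ h) (ψ k) (C.effect (mubPair h k)) := by
  rw [postGuessProd, postGuess_mubEnsemble, sum_mubPair]
  rfl

theorem IsCoeff.pairScore_le (hc : IsCoeff d qφ qψ α β) (hφ : 0 < qφ) (hψ : 0 < qψ)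
    (hq : qφ + qψ = 1) (hφψ : IsFourierConjugate φ ψ) (h k : ZMod d) {T : Op H}
    (hT : T.IsPositive) :
    pairScore qφ qψ (φ h) (ψ k) T ≤ mubOptimum d qφ qψ * (LinearMap.trace ℂ H T).re := by
  rw [← pairScore_phase qφ qψ (φ h) (ψ k) (-(h * k))]
  exact PostInfo.pairScore_le (φ.norm_eq_one h) (norm_phase ψ _ k) (hφψ.inner_phase_self h k)
    hc.1 hc.2.1 (one_div_pos.2 (sqrt_dim_pos d)) (mubOptimum_pos d qφ qψ)
    (hc.eigen_left hφ hψ hq) (hc.eigen_right hψ hq) hT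

theorem IsCoeff.exists_eq_smul (hc : IsCoeff d qφ qψ α β) (hφ : 0 < qφ) (hψ : 0 < qψ)
    (hq : qφ + qψ = 1) (hφψ : IsFourierConjugate φ ψ) {h k : ZMod d} {T : Op H}
    (hT : T.IsPositive)
    (hTe : pairScore qφ qψ (φ h) (ψ k) T = mubOptimum d qφ qψ * (LinearMap.trace ℂ H T).re) :
    ∃ c : ℝ, T = (c : ℂ) • ketbra (tilt φ ψ α β h k) (tilt φ ψ α β h k) := by
  rw [← pairScore_phase qφ qψ (φ h) (ψ k) (-(h * k))] at hTe
  exact exists_eq_smul_of_pairScore_eq (φ.norm_eq_one h) (norm_phase ψ _ k)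
    (hφψ.inner_phase_self h k) hc.1 hc.2.1 (one_div_pos.2 (sqrt_dim_pos d))
    (mubOptimum_pos d qφ qψ) (hc.eigen_left hφ hψ hq) (hc.eigen_right hψ hq) hT hTe

theorem IsCoeff.pairScore_smul_ketbra_tilt (hc : IsCoeff d qφ qψ α β) (hφ : 0 < qφ)
    (hψ : 0 < qψ) (hq : qφ + qψ = 1) (hφψ : IsFourierConjugate φ ψ) (h k : ZMod d) (c : ℝ) :
    pairScore qφ qψ (φ h) (ψ k)
        ((c : ℂ) • ketbra (tilt φ ψ α β h k) (tilt φ ψ α β h k)) =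
      mubOptimum d qφ qψ * (LinearMap.trace ℂ H
        ((c : ℂ) • ketbra (tilt φ ψ α β h k) (tilt φ ψ α β h k))).re := by
  rw [← pairScore_phase qφ qψ (φ h) (ψ k) (-(h * k)), pairScore_smul, pairScore_ketbra, tilt,
    two_rankOne_apply (φ.norm_eq_one h) (norm_phase ψ _ k) (hφψ.inner_phase_self h k) hc.1 hc.2.1
      (mubOptimum_pos d qφ qψ) (hc.eigen_left hφ hψ hq) (hc.eigen_right hψ hq),
    map_smul, smul_eq_mul, Complex.re_ofReal_mul, re_trace_ketbra_self]
  ring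

theorem IsCoeff.postGuess_le (hc : IsCoeff d qφ qψ α β) (hφψ : IsFourierConjugate φ ψ)
    {Y : Type*} [Fintype Y] (M : Measurement H Y) (f : ∀ ℓ, Y → (mubPartition d).Part ℓ) :
    postGuess (mubEnsemble φ ψ qφ qψ hφ hψ hq) (mubPartition d) M f ≤ mubOptimum d qφ qψ := by
  have hd : (0 : ℝ) < d := Nat.cast_pos.2 (NeZero.pos d)
  rw [postGuess_mubEnsemble, one_div_mul_eq_div, div_le_iff₀ hd]
  calc _ ≤ ∑ y, mubOptimum d qφ qψ * (LinearMap.trace ℂ H (M.effect y)).re :=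
        Finset.sum_le_sum fun y _ => hc.pairScore_le hφ hψ hq hφψ _ _ (M.pos y)
    _ = mubOptimum d qφ qψ * d := by
        rw [← Finset.mul_sum, M.sum_re_trace, finrank_eq_dim φ]

/-- The measurements on `X_φ × X_ψ` that attain the optimal value. -/
theorem IsCoeff.postGuessProd_eq_iff (hc : IsCoeff d qφ qψ α β) (hφψ : IsFourierConjugate φ ψ)
    (C : Measurement H (∀ ℓ, (mubPartition d).Part ℓ)) :
    postGuessProd (mubEnsemble φ ψ qφ qψ hφ hψ hq) (mubPartition d) C = mubOptimum d qφ qψ ↔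
      ∀ h k, ∃ c : ℝ, C.effect (mubPair h k) =
        (c : ℂ) • ketbra (tilt φ ψ α β h k) (tilt φ ψ α β h k) := by
  have hd : (0 : ℝ) < d := Nat.cast_pos.2 (NeZero.pos d)
  have htr : mubOptimum d qφ qψ * d = ∑ h, ∑ k,
      mubOptimum d qφ qψ * (LinearMap.trace ℂ H (C.effect (mubPair h k))).re := by
    have h := C.sum_re_trace
    rw [sum_mubPair, finrank_eq_dim φ] at h
    simp only [← Finset.mul_sum]
    rw [h]
  have hle : ∀ h k, pairScore qφ qψ (φ h) (ψ k) (C.effect (mubPair h k)) ≤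
      mubOptimum d qφ qψ * (LinearMap.trace ℂ H (C.effect (mubPair h k))).re :=
    fun h k => hc.pairScore_le hφ hψ hq hφψ h k (C.pos _)
  -- Equality of the totals forces equality in each termwise bound.
  rw [postGuessProd_mubEnsemble, one_div_mul_eq_div, div_eq_iff hd.ne', htr,
    Finset.sum_eq_sum_iff_of_le fun h _ => Finset.sum_le_sum fun k _ => hle h k]
  refine forall_congr' fun h => ?_
  rw [Finset.sum_eq_sum_iff_of_le fun k _ => hle h k]
  simp only [Finset.mem_univ, true_imp_iff]
  refine forall_congr' fun k => ⟨fun he => hc.exists_eq_smul hφ hψ hq hφψ (C.pos _) he, ?_⟩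
  rintro ⟨c, hC⟩
  rw [hC]
  exact hc.pairScore_smul_ketbra_tilt hφ hψ hq hφψ h k c

theorem ketbra_self_ne_zero {u : H} (hu : u ≠ 0) : ketbra u u ≠ 0 := by
  intro h
  have h2 := re_trace_ketbra_self u
  rw [h, map_zero] at h2
  exact hu (norm_eq_zero.1 (pow_eq_zero_iff two_ne_zero |>.1 h2.symm))

theorem IsCoeff.exists_ne_measurement (hc : IsCoeff d qφ qψ α β) (hφψ : IsFourierConjugate φ ψ)
    (hd : ¬ Odd d) : ∃ C : Measurement H (∀ ℓ, (mubPartition d).Part ℓ),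
      (∀ h k, ∃ c : ℝ, C.effect (mubPair h k) =
        (c : ℂ) • ketbra (tilt φ ψ α β h k) (tilt φ ψ α β h k)) ∧ C ≠ hc.measurement hφψ := by
  have hdpos : (0 : ℝ) < d := Nat.cast_pos.2 (NeZero.pos d)
  obtain ⟨m, hm⟩ := exists_omegaPow_eq_neg_one hd
  have h0 := hφψ.sum_re_omegaPow_ketbra_tilt α β (m := m) (n := 1) (by rwa [mul_one])
  have h1 := (hc.measurement hφψ).sum_eq_one
  rw [sum_mubPair] at h1
  simp only [hc.measurement_effect hφψ] at h1
  -- The real part of a unit-modulus character is at least `-1`, so the weights stay nonnegative. At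
  -- `(0, 0)` the weight is `2/d`, not `1/d`.
  let c : ZMod d → ZMod d → ℝ := fun h k => 1 / d + 1 / d * (omegaPow (m * h + 1 * k)).re
  have hc0 : ∀ h k, 0 ≤ c h k := by
    intro h k
    have h2 := Complex.abs_re_le_norm (omegaPow (m * h + 1 * k))
    rw [norm_omegaPow] at h2
    have h3 : 0 ≤ 1 / d * (1 + (omegaPow (m * h + 1 * k)).re) :=
      mul_nonneg (by positivity) (by linarith [(abs_le.1 h2).1])
    simp only [c]
    linarith
  have hsum : ∑ h, ∑ k, (c h k : ℂ) • ketbra (tilt φ ψ α β h k) (tilt φ ψ α β h k) = 1 := by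
    simp only [c, Complex.ofReal_add, Complex.ofReal_mul _ (omegaPow _).re, add_smul, mul_smul,
      Finset.sum_add_distrib, ← Finset.smul_sum, h0, smul_zero, add_zero]
    simpa only [← Finset.smul_sum] using h1
  refine ⟨rankOneMeasurement (tilt φ ψ α β) c hc0 hsum, fun h k => ⟨c h k, rfl⟩, fun h => ?_⟩
  have h2 := congrArg (fun C => Measurement.effect C (mubPair 0 0)) h
  simp only [hc.measurement_effect hφψ, rankOneMeasurement_effect] at h2
  have h3 := smul_left_injective ℂ (ketbra_self_ne_zero (hc.tilt_ne_zero hφψ 0 0)) h2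
  simp only [c, mul_zero, add_zero, omegaPow_zero, Complex.one_re, mul_one,
    Complex.ofReal_inj] at h3
  have : (0 : ℝ) < 1 / d := by positivity
  linarith

end measurement

end

end PostInfo

/-! ### The main theorem -/

theorem proposition4 {d : ℕ} [NeZero d]
    {H : Type*} [NormedAddCommGroup H] [InnerProductSpace ℂ H] [FiniteDimensional ℂ H]
    (φ ψ : OrthonormalBasis (ZMod d) ℂ H) (hφψ : PostInfo.IsFourierConjugate φ ψ)
    (qφ qψ : ℝ) (hφ : 0 < qφ) (hψ : 0 < qψ) (hq : qφ + qψ = 1) :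
    IsGreatest
      (PostInfo.postGuessValues (PostInfo.mubEnsemble φ ψ qφ qψ hφ hψ hq)
        (PostInfo.mubPartition d))
      (1 / 2 * (1 + Real.sqrt ((qφ - qψ) ^ 2 + 4 / d * (qφ * qψ)))) ∧
    (∃! c : ℝ × ℝ, PostInfo.IsCoeff d qφ qψ c.1 c.2) ∧
    ∀ α β : ℝ, PostInfo.IsCoeff d qφ qψ α β →
      ∃ C₀ : PostInfo.Measurement H (∀ ℓ, (PostInfo.mubPartition d).Part ℓ),
        (∀ h k : ZMod d,
          C₀.effect (PostInfo.mubPair h k) =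
            (1 / d : ℂ) • PostInfo.ketbra
              ((α : ℂ) • φ h + (β : ℂ) • PostInfo.omegaPow (-(h * k)) • ψ k)
              ((α : ℂ) • φ h + (β : ℂ) • PostInfo.omegaPow (-(h * k)) • ψ k)) ∧
        (∀ h k : ZMod d,
          C₀.effect (PostInfo.mubPair h k) =
            (1 / d : ℂ) • (PostInfo.weyl φ h k *
              PostInfo.ketbra ((α : ℂ) • φ 0 + (β : ℂ) • ψ 0) ((α : ℂ) • φ 0 + (β : ℂ) • ψ 0) *
              LinearMap.adjoint (PostInfo.weyl φ h k))) ∧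
        PostInfo.postGuessProd (PostInfo.mubEnsemble φ ψ qφ qψ hφ hψ hq)
          (PostInfo.mubPartition d) C₀ =
            1 / 2 * (1 + Real.sqrt ((qφ - qψ) ^ 2 + 4 / d * (qφ * qψ))) ∧
        IsMaxOn
          (PostInfo.postGuessProd (PostInfo.mubEnsemble φ ψ qφ qψ hφ hψ hq)
            (PostInfo.mubPartition d)) Set.univ C₀ ∧
        ((∀ C : PostInfo.Measurement H (∀ ℓ, (PostInfo.mubPartition d).Part ℓ),
            IsMaxOn
              (PostInfo.postGuessProd (PostInfo.mubEnsemble φ ψ qφ qψ hφ hψ hq)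
                (PostInfo.mubPartition d)) Set.univ C → C = C₀) ↔ Odd d) := by
  obtain ⟨⟨α₀, β₀⟩, hc₀, huniq⟩ := PostInfo.existsUnique_isCoeff (d := d) hφ hψ
  have hval : ∀ {α β : ℝ} (hc : PostInfo.IsCoeff d qφ qψ α β),
      PostInfo.postGuessProd (PostInfo.mubEnsemble φ ψ qφ qψ hφ hψ hq)
        (PostInfo.mubPartition d) (hc.measurement hφψ) = PostInfo.mubOptimum d qφ qψ :=
    fun hc => (hc.postGuessProd_eq_iff hφψ _).2 fun h k => ⟨_, hc.measurement_effect hφψ h k⟩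
  refine ⟨⟨⟨_, inferInstance, hc₀.measurement hφψ, fun ℓ x => x ℓ, (hval hc₀).symm⟩, ?_⟩,
    ⟨(α₀, β₀), hc₀, huniq⟩, fun α β hc => ?_⟩
  · rintro p ⟨Y, _, M, f, rfl⟩
    exact hc₀.postGuess_le hφψ M f
  have heff : ∀ h k : ZMod d, (hc.measurement hφψ).effect (PostInfo.mubPair h k) =
      (1 / d : ℂ) • PostInfo.ketbra (PostInfo.tilt φ ψ α β h k)
        (PostInfo.tilt φ ψ α β h k) := fun h k => by
    rw [hc.measurement_effect hφψ]
    push_cast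
    rfl
  have hmax : IsMaxOn (PostInfo.postGuessProd (PostInfo.mubEnsemble φ ψ qφ qψ hφ hψ hq)
      (PostInfo.mubPartition d)) Set.univ (hc.measurement hφψ) := fun C _ =>
    (hc.postGuess_le hφψ C _).trans (hval hc).ge
  refine ⟨hc.measurement hφψ, heff, fun h k => ?_, hval hc, hmax, fun hall => ?_,
    fun hd C hC => ?_⟩
  · rw [PostInfo.mul_ketbra_mul_adjoint, hφψ.weyl_tilt, heff]
  · by_contra hd
    obtain ⟨C, hC, hne⟩ := hc.exists_ne_measurement hφψ hd
    refine hne (hall C fun C' _ => ?_)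
    exact (hc.postGuess_le hφψ C' _).trans ((hc.postGuessProd_eq_iff hφψ C).2 hC).ge
  · refine hc.eq_measurement_of_odd hφψ hd ((hc.postGuessProd_eq_iff (hφ := hφ) (hψ := hψ)
      (hq := hq) hφψ C).1 (le_antisymm (hc.postGuess_le hφψ C _) ?_))
    exact (hval hc).symm.le.trans (hC (Set.mem_univ _))
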